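/- Let $\mathbb{K}$ be a field of characteristic zero, $R=\mathbb{K}[x_1,\ldots,x_n]$, and $\mathfrak{m}=\langle x_1,\ldots,x_n\rangle$. For ideals $J,L\subseteq R$, their join is the ideal $$J\star L \;=\; \bigl(J(\mathbf{v})+L(\mathbf{w})+\langle x_i-v_i-w_i : 1\le i\le n\rangle\bigr)\cap R,$$ where the ideal in parentheses lives in the polynomial ring $\mathbb{K}[\mathbf{x},\mathbf{v},\mathbf{w}]$ in $3n$ variables, and $J(\mathbf{v})$, $L(\mathbf{w})$ are obtained from $J$, $L$ by substituting $v_i$, respectively $w_i$, for $x_i$. For an $\mathfrak{m}$-primary ideal $M$, let $$M^\perp=\{F\in\mathbb{K}[z_1,\ldots,z_n] : f(\partial_{z_1},\ldots,\partial_{z_n})\bullet F=0 \text{ for all } f\in M\}$$ be its inverse system, and let $\mathfrak{A}(M)\subset\mathbb{K}[\partial_{x_1},\ldots,\partial_{x_n}]$ be the image of $M^\perp$ under the $\mathbb{K}$-linear map $\mathbf{z}^\alpha\mapsto\partial_{\mathbf{x}}^\alpha$. Here $\bullet$ denotes the application of a differential operator to a polynomial. For $r\in\mathbb{N}$, the $r$-th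 symbolic power of $J$ is $J^{(r)}=\bigcap_{\mathfrak{p}\in\mathrm{Ass}(R/J)}\bigl(J^rR_{\mathfrak{p}}\cap R\bigr)$, where $J^rR_{\mathfrak{p}}\cap R$ is the preimage of $J^rR_{\mathfrak{p}}$ under $R\to R_{\mathfrak{p}}$, and an empty intersection is $R$. Let $J$ be any ideal in $R$. (i) For every $\mathfrak{m}$-primary ideal $M$ of $R$, $$J\star M=\{f\in R : A\bullet f\in J \text{ for all } A\in\mathfrak{A}(M)\}.$$ (ii) If $J$ is radical and $r\in\mathbb{N}$, then $$J^{(r)}=J\star\mathfrak{m}^r=\{f\in R : \partial_{\mathbf{x}}^\alpha\bullet f\in J \text{ for all } \alpha\in\mathbb{N}^n \text{ with } |\alpha|\le r-1\}.$$ -/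

import Mathlib

open MvPolynomial

noncomputable section

/-- The join `J ⋆ L` of two ideals of `R = K[x₁, …, xₙ]`: the ideal
`(J(v) + L(w) + ⟨xᵢ - vᵢ - wᵢ : i⟩) ∩ R`. The polynomial ring in the `3n` variables `x, v, w` has the
index set `Fin n ⊕ Fin n ⊕ Fin n` (first summand `x`, second `v`, third `w`), and intersecting
with `R` is the contraction along the inclusion `xᵢ ↦ xᵢ`. -/
def idealJoin {K : Type*} [Field K] {n : ℕ} (J L : Ideal (MvPolynomial (Fin n) K)) :
    Ideal (MvPolynomial (Fin n) K) :=
  Ideal.comap (rename Sum.inl : MvPolynomial (Fin n) K →ₐ[K]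
      MvPolynomial (Fin n ⊕ Fin n ⊕ Fin n) K)
    (Ideal.map (rename (fun i => Sum.inr (Sum.inl i)) : MvPolynomial (Fin n) K →ₐ[K]
        MvPolynomial (Fin n ⊕ Fin n ⊕ Fin n) K) J ⊔
      Ideal.map (rename (fun i => Sum.inr (Sum.inr i)) : MvPolynomial (Fin n) K →ₐ[K]
        MvPolynomial (Fin n ⊕ Fin n ⊕ Fin n) K) L ⊔
      Ideal.span (Set.range fun i : Fin n =>
        (X (Sum.inl i) - X (Sum.inr (Sum.inl i)) - X (Sum.inr (Sum.inr i)) :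
          MvPolynomial (Fin n ⊕ Fin n ⊕ Fin n) K)))

/-- The iterated partial derivative `∂^α = ∂₁^α₁ ∘ ⋯ ∘ ∂ₙ^αₙ` on `K[x₁, …, xₙ]`. -/
def partialDeriv (K : Type*) [Field K] {n : ℕ} (α : Fin n →₀ ℕ) :
    Module.End K (MvPolynomial (Fin n) K) :=
  (List.ofFn fun i : Fin n =>
    ((pderiv i : Derivation K (MvPolynomial (Fin n) K) (MvPolynomial (Fin n) K)) :
      Module.End K (MvPolynomial (Fin n) K)) ^ α i).prod

/-- The `K`-linear map `F = ∑ c_α z^α ↦ F(∂) = ∑ c_α ∂^α` from polynomials to differential operators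
with constant coefficients, the latter acting on polynomials. -/
def toDiffOp (K : Type*) [Field K] (n : ℕ) :
    MvPolynomial (Fin n) K →ₗ[K] Module.End K (MvPolynomial (Fin n) K) :=
  (basisMonomials (Fin n) K).constr K (partialDeriv K)

/-- The inverse system `M^⊥ = {F ∈ K[z₁, …, zₙ] : f(∂_z) • F = 0 for all f ∈ M}`. -/
def inverseSystem {K : Type*} [Field K] {n : ℕ} (M : Ideal (MvPolynomial (Fin n) K)) :
    Submodule K (MvPolynomial (Fin n) K) where
  carrier := {F | ∀ f ∈ M, toDiffOp K n f F = 0}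
  add_mem' := fun ha hb f hf => by rw [map_add, ha f hf, hb f hf, add_zero]
  zero_mem' := fun f _ => map_zero (toDiffOp K n f)
  smul_mem' := fun c F hF f hf => by rw [map_smul, hF f hf, smul_zero]

/-- The space `𝔄(M)` of differential operators associated to `M`: the image of `M^⊥` under
`z^α ↦ ∂_x^α`. -/
def associatedDiffOps {K : Type*} [Field K] {n : ℕ} (M : Ideal (MvPolynomial (Fin n) K)) :
    Submodule K (Module.End K (MvPolynomial (Fin n) K)) :=
  (inverseSystem M).map (toDiffOp K n)

/-- The `r`-th symbolic power `J^(r) = ⋂_{𝔭 ∈ Ass(R/J)} (J^r R_𝔭 ∩ R)`. -/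
def symbolicPower {R : Type*} [CommRing R] (J : Ideal R) (r : ℕ) : Ideal R :=
  ⨅ p : associatedPrimes R (R ⧸ J),
    Ideal.comap (algebraMap R (Localization.AtPrime p.1))
      (Ideal.map (algebraMap R (Localization.AtPrime p.1)) (J ^ r))

end

/-! # Joins with `𝔪`-primary ideals, differential operators and symbolic powers

Eliminating `x` turns membership `f ∈ J ⋆ M` into a statement about the Taylor expansion
`f(v + w) = ∑ (∂^α f)(v) w^α / α!`, viewed as a polynomial in `w` over `R = K[v]`: it has to lie in
the extension `J(v) + M(w)` (`mem_idealJoin_iff`). Choose a `K`-basis of `R/M` and take coordinates: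
a polynomial `g` in `w` over `R` lies in `J(v) + M(w)` exactly when each `K`-linear functional on
`K[w]` that kills `M`, applied to `g` in the variables `w`, gives an element of `J`. Since `M`
contains a power of `𝔪`, each such functional is `w^α ↦ α! F_α` for a polynomial `F`, and `F` then
lies in the inverse system of `M` (`mem_map_sup_map_iff`). Applied to the Taylor expansion of `f`,
the functional of `F` gives `∑ F_α ∂^α f = F(∂) f` (`toDiffOp_eq_apolarPairing`). This proves the
description of `J ⋆ M`; for `M = 𝔪^r` the inverse system is spanned by the monomials of degree `< r`,
so `J ⋆ 𝔪^r` is the differential power of `J` (`idealJoin_pow_idealOfVars`).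

The equality of symbolic and differential powers of a radical ideal is the theorem of Zariski and
Nagata. An associated prime `p` of a radical ideal `J` is `J : a` for some `a ∉ p`, so `J` and `p`
agree in the localization at `p` and everything reduces to primes. The `r`-th
differential power of a prime `p` contains `p^r`, and elements outside `p` are nonzerodivisors modulo
it, which gives one inclusion. For the other, the residue field of `R_p`
is formally smooth over `K`, hence the conormal map `𝔪_p/𝔪_p² → κ(p) ⊗ Ω` has a retraction. It
provides an Euler-type derivation `E = ∑ c_j ∂_j` with `c_j ∈ 𝔪_p` and `E g ≡ g` modulo `𝔪_p²` for
`g ∈ p` (`exists_sub_sum_pderiv_mem_sq`), so `E f ≡ r f` modulo `𝔪_p^(r+1)` for `f ∈ p^r`. If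
moreover all derivatives `∂_j f` lie in `𝔪_p^r`, then `E f ∈ 𝔪_p^(r+1)`, and dividing by `r` gives
`f ∈ 𝔪_p^(r+1)` (`algebraMap_mem_pow_of_mem_differentialPower`).
-/

open scoped Nat

/-! ### Iterated partial derivatives -/

theorem List.prod_ofFn_mul_of_commute {M : Type*} [Monoid M] {n : ℕ} (f g : Fin n → M)
    (h : ∀ i j, Commute (f i) (g j)) :
    (List.ofFn fun i => f i * g i).prod = (List.ofFn f).prod * (List.ofFn g).prod := by
  induction n with
  | zero => simp
  | succ n ih =>
    simp only [List.ofFn_succ, List.prod_cons]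
    rw [ih (fun i => f i.succ) (fun i => g i.succ) fun i j => h _ _]
    have : Commute (List.ofFn fun i => f (Fin.succ i)).prod (g 0) :=
      Commute.list_prod_left _ _ fun x hx => by
        obtain ⟨i, rfl⟩ := (List.mem_ofFn' _ _).1 hx
        exact h _ _
    rw [mul_assoc, ← mul_assoc (g 0), ← this.eq]
    simp only [mul_assoc]

theorem List.prod_ofFn_mulSingle {M : Type*} [Monoid M] {n : ℕ} (i : Fin n) (a : M) :
    (List.ofFn (Pi.mulSingle i a)).prod = a := by
  induction n with
  | zero => exact i.elim0
  | succ n ih =>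
    rw [List.ofFn_succ, List.prod_cons]
    cases i using Fin.cases with
    | zero =>
      rw [Pi.mulSingle_eq_same, List.prod_eq_one, mul_one]
      intro x hx
      obtain ⟨j, rfl⟩ := (List.mem_ofFn' _ _).1 hx
      exact Pi.mulSingle_eq_of_ne (Fin.succ_ne_zero j) _
    | succ i =>
      rw [Pi.mulSingle_eq_of_ne (Fin.succ_ne_zero i).symm, one_mul]
      convert! ih i using 3
      ext j
      simp [Pi.mulSingle_apply]

section ZariskiNagata

variable {K : Type*} [Field K] {n : ℕ}

theorem commute_pderiv (i j : Fin n) :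
    Commute ((pderiv i : Derivation K (MvPolynomial (Fin n) K) (MvPolynomial (Fin n) K)) :
        Module.End K (MvPolynomial (Fin n) K))
      ((pderiv j : Derivation K (MvPolynomial (Fin n) K) (MvPolynomial (Fin n) K)) :
        Module.End K (MvPolynomial (Fin n) K)) := by
  classical
  have h : ⁅pderiv (R := K) i, pderiv (R := K) j⁆ = 0 := by
    ext k
    simp [Derivation.commutator_apply, pderiv_X, Pi.single_apply, apply_ite]
  refine LinearMap.ext fun f => ?_
  have := congr($h f)
  simpa [Derivation.commutator_apply, sub_eq_zero] using this

theorem partialDeriv_zero : partialDeriv K (0 : Fin n →₀ ℕ) = 1 := by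
  refine List.prod_eq_one fun x hx => ?_
  obtain ⟨i, rfl⟩ := (List.mem_ofFn' _ _).1 hx
  simp

theorem partialDeriv_add (α β : Fin n →₀ ℕ) :
    partialDeriv K (α + β) = partialDeriv K α * partialDeriv K β := by
  simp only [partialDeriv]
  rw [← List.prod_ofFn_mul_of_commute]
  · simp [pow_add]
  · exact fun i j => (commute_pderiv i j).pow_pow _ _

theorem partialDeriv_single (i : Fin n) :
    partialDeriv K (Finsupp.single i 1) = (pderiv i : Derivation K (MvPolynomial (Fin n) K) _) := by
  classical
  rw [partialDeriv]
  convert! List.prod_ofFn_mulSingle i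
    ((pderiv i : Derivation K (MvPolynomial (Fin n) K) (MvPolynomial (Fin n) K)) :
      Module.End K (MvPolynomial (Fin n) K)) using 3
  ext1 j
  rcases eq_or_ne j i with rfl | h
  · simp
  · simp [h]

theorem partialDeriv_add_single (α : Fin n →₀ ℕ) (i : Fin n) (f : MvPolynomial (Fin n) K) :
    partialDeriv K (α + Finsupp.single i 1) f = partialDeriv K α (pderiv i f) := by
  rw [partialDeriv_add, partialDeriv_single]; rfl

/-! ### Differential powers of an ideal -/

variable {J : Ideal (MvPolynomial (Fin n) K)} {r : ℕ} {f : MvPolynomial (Fin n) K}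

/-- The recursion on the order that every induction on differential powers uses; it is stated on
elements because the proof that differential powers are ideals already needs it. -/
theorem forall_partialDeriv_mem_succ :
    (∀ α : Fin n →₀ ℕ, α.degree < r + 1 → partialDeriv K α f ∈ J) ↔
      f ∈ J ∧ ∀ i, ∀ α : Fin n →₀ ℕ, α.degree < r → partialDeriv K α (pderiv i f) ∈ J := by
  constructor
  · refine fun h => ⟨by simpa [partialDeriv_zero] using h 0 (by simp), fun i α hα => ?_⟩
    rw [← partialDeriv_add_single]
    exact h _ (by simpa using hα)
  · rintro ⟨h0, h⟩ α hα
    rcases eq_or_ne α 0 with rfl | hne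
    · simpa [partialDeriv_zero] using h0
    · obtain ⟨i, hi⟩ := Finsupp.ne_iff.1 hne
      have : Finsupp.single i 1 ≤ α := by
        simpa [Finsupp.single_le_iff, Nat.one_le_iff_ne_zero] using hi
      obtain ⟨β, rfl⟩ := exists_add_of_le this
      rw [add_comm, partialDeriv_add_single]
      refine h i β ?_
      simp at hα
      omega

variable (J r) in
/-- The `r`-th differential power of `J`: the polynomials all of whose partial derivatives of order
less than `r`, including order `0`, lie in `J`. For `r = 0` this is the whole ring. -/
def differentialPower : Ideal (MvPolynomial (Fin n) K) where
  carrier := {f | ∀ α : Fin n →₀ ℕ, α.degree < r → partialDeriv K α f ∈ J}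
  add_mem' ha hb α hα := by rw [map_add]; exact J.add_mem (ha α hα) (hb α hα)
  zero_mem' α _ := by rw [map_zero]; exact J.zero_mem
  smul_mem' a f hf := by
    induction r generalizing a f with
    | zero => exact fun α hα => absurd hα (Nat.not_lt_zero _)
    | succ r ih =>
      have hf' := forall_partialDeriv_mem_succ.1 hf
      refine forall_partialDeriv_mem_succ.2 ⟨J.mul_mem_left _ hf'.1, fun i α hα => ?_⟩
      rw [smul_eq_mul, pderiv_mul, map_add, mul_comm (pderiv i a)]
      refine J.add_mem ?_ (ih a _ (hf'.2 i) α hα)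
      rw [mul_comm]
      exact ih _ f (fun β hβ => hf β (hβ.trans (Nat.lt_succ_self r))) α hα

theorem mem_differentialPower : f ∈ differentialPower J r ↔
    ∀ α : Fin n →₀ ℕ, α.degree < r → partialDeriv K α f ∈ J := Iff.rfl

theorem mem_differentialPower_succ : f ∈ differentialPower J (r + 1) ↔
    f ∈ J ∧ ∀ i, pderiv i f ∈ differentialPower J r := forall_partialDeriv_mem_succ

theorem differentialPower_zero : differentialPower J 0 = ⊤ :=
  eq_top_iff.2 fun _ _ _ hα => absurd hα (Nat.not_lt_zero _)

theorem differentialPower_succ_le : differentialPower J (r + 1) ≤ differentialPower J r :=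
  fun _ hf α hα => hf α (hα.trans (Nat.lt_succ_self r))

theorem mul_mem_differentialPower_succ {a : MvPolynomial (Fin n) K} (ha : a ∈ J)
    (hf : f ∈ differentialPower J r) : a * f ∈ differentialPower J (r + 1) := by
  induction r generalizing f with
  | zero =>
    exact mem_differentialPower_succ.2 ⟨J.mul_mem_right _ ha, fun i => by
      simp [differentialPower_zero]⟩
  | succ r ih =>
    refine mem_differentialPower_succ.2 ⟨J.mul_mem_right _ ha, fun i => ?_⟩
    rw [pderiv_mul]
    exact add_mem (Ideal.mul_mem_left _ _ hf) (ih ((mem_differentialPower_succ.1 hf).2 i))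

theorem pow_le_differentialPower : J ^ r ≤ differentialPower J r := by
  induction r with
  | zero => simp [differentialPower_zero]
  | succ r ih =>
    rw [pow_succ', Ideal.mul_le]
    exact fun a ha f hf => mul_mem_differentialPower_succ ha (ih hf)

/-- Elements outside a prime ideal are nonzerodivisors modulo its differential powers. -/
theorem mem_differentialPower_of_mul_mem [hJ : J.IsPrime] {s : MvPolynomial (Fin n) K} (hs : s ∉ J)
    (h : s * f ∈ differentialPower J r) : f ∈ differentialPower J r := by
  induction r generalizing f with
  | zero => simp [differentialPower_zero]
  | succ r ih =>
    have hf := ih (differentialPower_succ_le h)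
    rw [mem_differentialPower_succ] at h ⊢
    refine ⟨(hJ.mem_or_mem h.1).resolve_left hs, fun i => ih ?_⟩
    have := h.2 i
    rw [pderiv_mul] at this
    exact (Ideal.add_mem_iff_right _ (Ideal.mul_mem_left _ _ hf)).1 this

/-! ### The Euler-type derivation at a prime -/

open IsLocalRing

/-- The conormal map of the residue field of an essentially smooth local algebra over a perfect field
splits, because the residue field is formally smooth. -/
theorem exists_kaehlerDifferential_retraction (K A : Type*) [Field K] [PerfectField K] [CommRing A]
    [IsLocalRing A] [Algebra K A] [Algebra.FormallySmooth K A] [Algebra.EssFiniteType K A] :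
    ∃ l : Ω[A⁄K] →ₗ[A] (maximalIdeal A).Cotangent,
      ∀ x : maximalIdeal A, l (KaehlerDifferential.D K A x) = (maximalIdeal A).toCotangent x := by
  have : Algebra.EssFiniteType K (ResidueField A) := .comp K A _
  obtain ⟨l, hl⟩ := (Algebra.FormallySmooth.iff_split_injection
    (R := K) (P := A) (A := ResidueField A) residue_surjective).1 inferInstance
  have hk : RingHom.ker (algebraMap A (ResidueField A)) = maximalIdeal A := ker_residue
  rw [← hk]
  refine ⟨l ∘ₗ (TensorProduct.mk A (ResidueField A) _ 1), fun x => ?_⟩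
  rw [← LinearMap.id_apply (R := A) (Ideal.toCotangent _ x), ← hl]
  simp only [LinearMap.comp_apply, KaehlerDifferential.kerCotangentToTensor_toCotangent]
  rfl

theorem derivation_eq_sum_pderiv {M : Type*} [AddCommGroup M] [Module K M]
    [Module (MvPolynomial (Fin n) K) M] [IsScalarTower K (MvPolynomial (Fin n) K) M]
    (D : Derivation K (MvPolynomial (Fin n) K) M) (g : MvPolynomial (Fin n) K) :
    D g = ∑ j, (pderiv j g : MvPolynomial (Fin n) K) • D (X j : MvPolynomial (Fin n) K) := by
  classical
  have h : D = ∑ j : Fin n, (LinearMap.toSpanSingleton (MvPolynomial (Fin n) K) M (D (X j))).compDer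
      (pderiv j) := by
    ext i
    rw [← Derivation.coeFnAddMonoidHom_apply (∑ j, _), map_sum, Finset.sum_apply]
    simp [pderiv_X, Pi.single_apply]
  nth_rw 1 [h]
  rw [← Derivation.coeFnAddMonoidHom_apply (∑ j, _), map_sum, Finset.sum_apply]
  simp

/-- There is a derivation `∑ c_j ∂_j` with values in the localization at `p` and coefficients in its
maximal ideal that acts as the identity on `p` modulo the square of the maximal ideal. -/
theorem exists_sub_sum_pderiv_mem_sq [CharZero K] (p : Ideal (MvPolynomial (Fin n) K))
    [p.IsPrime] :
    ∃ c : Fin n → Localization.AtPrime p, (∀ j, c j ∈ maximalIdeal (Localization.AtPrime p)) ∧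
      ∀ g ∈ p, algebraMap _ (Localization.AtPrime p) g -
        ∑ j, c j * algebraMap _ (Localization.AtPrime p) (pderiv j g) ∈
          maximalIdeal (Localization.AtPrime p) ^ 2 := by
  have : Algebra.FormallySmooth (MvPolynomial (Fin n) K) (Localization.AtPrime p) :=
    .of_isLocalization p.primeCompl
  have : Algebra.FormallySmooth K (Localization.AtPrime p) :=
    .comp K (MvPolynomial (Fin n) K) _
  obtain ⟨l, hl⟩ := exists_kaehlerDifferential_retraction K (Localization.AtPrime p)
  choose c hc using fun j => Ideal.toCotangent_surjective _
    (l (KaehlerDifferential.D K _ (algebraMap (MvPolynomial (Fin n) K)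
      (Localization.AtPrime p) (X j))))
  refine ⟨fun j => c j, fun j => (c j).2, fun g hg => ?_⟩
  have hD : ∀ g : MvPolynomial (Fin n) K,
      KaehlerDifferential.D K _ (algebraMap _ (Localization.AtPrime p) g) =
        ∑ j, algebraMap _ (Localization.AtPrime p) (pderiv j g) •
          KaehlerDifferential.D K _ (algebraMap (MvPolynomial (Fin n) K)
            (Localization.AtPrime p) (X j)) := by
    intro g
    exact (derivation_eq_sum_pderiv
      ((KaehlerDifferential.D K (Localization.AtPrime p)).compAlgebraMap
        (MvPolynomial (Fin n) K)) g).trans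
        (Finset.sum_congr rfl fun j _ => by
          rw [Derivation.compAlgebraMap_apply]
          exact (algebraMap_smul (M := Ω[Localization.AtPrime p⁄K]) (Localization.AtPrime p)
            (pderiv j g) _).symm)
  have hg' : algebraMap _ (Localization.AtPrime p) g ∈ maximalIdeal (Localization.AtPrime p) :=
    (IsLocalization.AtPrime.to_map_mem_maximal_iff _ p g).2 hg
  have h := hl ⟨_, hg'⟩
  rw [hD, map_sum] at h
  simp_rw [map_smul, ← hc, ← map_smul, ← map_sum] at h
  rw [eq_comm, Ideal.toCotangent_eq] at h
  simpa [Algebra.smul_def, mul_comm] using h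

/-- Euler's identity: a derivation that is the identity on `p` modulo the square of the maximal ideal
is multiplication by `r` on `p ^ r` modulo the next power. -/
theorem natCast_mul_sub_sum_pderiv_mem_pow {p : Ideal (MvPolynomial (Fin n) K)} [p.IsPrime]
    {c : Fin n → Localization.AtPrime p}
    (hc : ∀ g ∈ p, algebraMap _ (Localization.AtPrime p) g -
        ∑ j, c j * algebraMap _ (Localization.AtPrime p) (pderiv j g) ∈
          maximalIdeal (Localization.AtPrime p) ^ 2) (hr : r ≠ 0)
    (hf : f ∈ p ^ r) : (r : Localization.AtPrime p) * algebraMap _ (Localization.AtPrime p) f -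
        ∑ j, c j * algebraMap _ (Localization.AtPrime p) (pderiv j f) ∈
          maximalIdeal (Localization.AtPrime p) ^ (r + 1) := by
  have hmem : ∀ {k : ℕ} {g}, g ∈ p ^ k → algebraMap _ (Localization.AtPrime p) g ∈
      maximalIdeal (Localization.AtPrime p) ^ k := fun {k g} hg => by
    rw [← Localization.AtPrime.map_eq_maximalIdeal, ← Ideal.map_pow]
    exact Ideal.mem_map_of_mem _ hg
  induction r, Nat.one_le_iff_ne_zero.2 hr using Nat.le_induction generalizing f with
  | base => simpa using hc f (by simpa using hf)
  | succ r hr' ih =>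
    rw [pow_succ] at hf
    induction hf using Submodule.mul_induction_on' with
    | mem_mul_mem a ha b hb =>
      have h1 := Ideal.mul_mem_mul (ih (by omega) ha) (hmem (k := 1) (by simpa using hb))
      have h2 := Ideal.mul_mem_mul (hmem ha) (hc b hb)
      rw [← pow_add] at h1 h2
      convert add_mem h1 h2 using 1
      simp only [pderiv_mul, map_add, map_mul, mul_add, Finset.sum_add_distrib, sub_mul, mul_sub,
        Finset.sum_mul, Finset.mul_sum, Nat.cast_add, Nat.cast_one, add_mul, one_mul]
      simp only [mul_comm, mul_left_comm]
      ring
    | add a _ b _ ha hb =>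
      convert add_mem ha hb using 1
      simp only [map_add, mul_add, Finset.sum_add_distrib]
      ring

/-- The hard inclusion in the theorem of Zariski and Nagata, for a prime ideal. -/
theorem algebraMap_mem_pow_of_mem_differentialPower [CharZero K]
    {p : Ideal (MvPolynomial (Fin n) K)} [p.IsPrime] (hf : f ∈ differentialPower p r) :
    algebraMap _ (Localization.AtPrime p) f ∈ maximalIdeal (Localization.AtPrime p) ^ r := by
  obtain ⟨c, hcm, hc⟩ := exists_sub_sum_pderiv_mem_sq p
  induction r generalizing f with
  | zero => simp
  | succ r ih =>
    rcases Nat.eq_zero_or_pos r with rfl | hr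
    · rw [zero_add, pow_one, IsLocalization.AtPrime.to_map_mem_maximal_iff _ p]
      exact (mem_differentialPower_succ.1 hf).1
    have h := ih (differentialPower_succ_le hf)
    rw [← Localization.AtPrime.map_eq_maximalIdeal, ← Ideal.map_pow,
      IsLocalization.algebraMap_mem_map_algebraMap_iff p.primeCompl] at h
    -- Clear denominators: Euler's identity is available for `s * f`, which lies in `p ^ r` itself.
    obtain ⟨s, hs, hsf⟩ := h
    have hsf' := (mem_differentialPower_succ.1 (Ideal.mul_mem_left _ s hf)).2
    have hE : ∑ j, c j * algebraMap _ (Localization.AtPrime p) (pderiv j (s * f)) ∈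
        maximalIdeal (Localization.AtPrime p) ^ (r + 1) := by
      rw [pow_succ']
      exact sum_mem fun j _ => Ideal.mul_mem_mul (hcm j) (ih (hsf' j))
    have h := (Submodule.sub_mem_iff_left _ hE).1 (natCast_mul_sub_sum_pderiv_mem_pow hc hr.ne' hsf)
    have hru : IsUnit (r : Localization.AtPrime p) := by
      have : IsUnit (algebraMap K (Localization.AtPrime p) r) :=
        (isUnit_iff_ne_zero.2 (Nat.cast_ne_zero.2 hr.ne')).map _
      simpa using this
    rw [Ideal.unit_mul_mem_iff_mem _ hru, map_mul, Ideal.unit_mul_mem_iff_mem] at h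
    · exact h
    · exact IsLocalization.map_units _ (⟨s, hs⟩ : p.primeCompl)

/-! ### Symbolic powers of radical ideals -/

/-- An associated prime `p` of a radical ideal `J` is `J : a`, and `a ∉ p` since `a ∈ p` would give
`a ^ 2 ∈ J`. Hence `J` and `p` agree in the localization at `p`. -/
theorem exists_notMem_mul_mem_of_mem_associatedPrimes {R : Type*} [CommRing R] [IsNoetherianRing R]
    {J p : Ideal R} (hJ : J.IsRadical) (hp : p ∈ associatedPrimes R (R ⧸ J)) :
    J ≤ p ∧ ∃ a ∉ p, ∀ x ∈ p, a * x ∈ J := by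
  obtain ⟨hpp, x, hx⟩ := isAssociatedPrime_iff.1 hp
  obtain ⟨a, rfl⟩ := Ideal.Quotient.mk_surjective x
  have hmem : ∀ y, y ∈ p ↔ y * a ∈ J := fun y => by
    rw [hx, Submodule.mem_colon_singleton, Submodule.mem_bot, ← Ideal.Quotient.eq_zero_iff_mem]
    simp [Algebra.smul_def]
  refine ⟨fun y hy => (hmem y).2 (J.mul_mem_right _ hy), a, fun ha => ?_, fun y hy => ?_⟩
  · have : a ∈ J := hJ ⟨2, by simpa [pow_two] using (hmem a).1 ha⟩
    exact hpp.ne_top ((Ideal.eq_top_iff_one _).2 ((hmem 1).2 (by simpa using this)))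
  · rw [mul_comm]; exact (hmem y).1 hy

theorem mem_of_forall_associatedPrimes {R : Type*} [CommRing R] [IsNoetherianRing R]
    {J : Ideal R} {f : R} (h : ∀ p ∈ associatedPrimes R (R ⧸ J), ∃ s ∉ p, s * f ∈ J) : f ∈ J := by
  by_contra hf
  obtain ⟨p, hp, hle⟩ := exists_le_isAssociatedPrime_of_isNoetherianRing R
    (Ideal.Quotient.mk J f) (by rwa [Ne, Ideal.Quotient.eq_zero_iff_mem])
  obtain ⟨s, hs, hsf⟩ := h p hp
  refine hs (hle ?_)
  rw [Submodule.mem_colon_singleton, Submodule.mem_bot]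
  simpa [Algebra.smul_def, ← map_mul] using Ideal.Quotient.eq_zero_iff_mem.2 hsf

/-- The theorem of Zariski and Nagata for radical ideals. -/
theorem symbolicPower_eq_differentialPower [CharZero K] (hJ : J.IsRadical) (r : ℕ) :
    symbolicPower J r = differentialPower J r := by
  have key : ∀ (p : Ideal (MvPolynomial (Fin n) K)) [p.IsPrime] (I : Ideal _) (f),
      f ∈ Ideal.comap (algebraMap _ (Localization.AtPrime p))
        (Ideal.map (algebraMap _ (Localization.AtPrime p)) I) ↔ ∃ s ∉ p, s * f ∈ I := by
    intro p _ I f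
    rw [Ideal.mem_comap, IsLocalization.algebraMap_mem_map_algebraMap_iff p.primeCompl]
    rfl
  ext f
  rw [symbolicPower, Submodule.mem_iInf]
  constructor
  · intro h α hα
    refine mem_of_forall_associatedPrimes fun p hp => ?_
    obtain ⟨hJp, a, ha, haJ⟩ := exists_notMem_mul_mem_of_mem_associatedPrimes hJ hp
    have : p.IsPrime := hp.isPrime
    obtain ⟨s, hs, hsf⟩ := (key _ _ _).1 (h ⟨p, hp⟩)
    refine ⟨a, ha, haJ _ ?_⟩
    exact mem_differentialPower_of_mul_mem hs
      (pow_le_differentialPower (Ideal.pow_right_mono hJp r hsf)) α hα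
  · rintro hf ⟨p, hp⟩
    obtain ⟨hJp, a, ha, haJ⟩ := exists_notMem_mul_mem_of_mem_associatedPrimes hJ hp
    have : p.IsPrime := hp.isPrime
    have hfp : f ∈ differentialPower p r := fun α hα => hJp (hf α hα)
    have h := algebraMap_mem_pow_of_mem_differentialPower hfp
    rw [← Localization.AtPrime.map_eq_maximalIdeal, ← Ideal.map_pow,
      IsLocalization.algebraMap_mem_map_algebraMap_iff p.primeCompl] at h
    obtain ⟨s, hs, hsf⟩ := h
    refine (key _ _ _).2 ⟨a ^ r * s, fun hmem => (this.mem_or_mem hmem).elim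
      (fun h => ha (this.mem_of_pow_mem _ h)) hs, ?_⟩
    have : Ideal.span {a} * p ≤ J := by
      rw [Ideal.mul_le]
      intro x hx y hy
      obtain ⟨z, rfl⟩ := Ideal.mem_span_singleton'.1 hx
      rw [mul_assoc]
      exact J.mul_mem_left _ (haJ y hy)
    rw [mul_assoc]
    refine Ideal.pow_right_mono this r ?_
    rw [mul_pow]
    exact Ideal.mul_mem_mul (Ideal.pow_mem_pow (Ideal.mem_span_singleton_self a) r) hsf

end ZariskiNagata

section ApolarityAndJoin

variable {K : Type*} [Field K] {n : ℕ}

/-! ### The apolarity pairing and inverse systems -/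

section Pairing

variable {A : Type*} [CommRing A] [Algebra K A]

theorem prod_factorial_add_single (α : Fin n →₀ ℕ) (i : Fin n) :
    ∏ j, ((α + Finsupp.single i 1 : Fin n →₀ ℕ) j)! = (∏ j, (α j)!) * (α i + 1) := by
  classical
  have h : ∀ j, ((α + Finsupp.single i 1 : Fin n →₀ ℕ) j)! =
      (α j)! * if j = i then α i + 1 else 1 := by
    intro j
    split_ifs with hj
    · subst hj
      simp [Nat.factorial_succ, mul_comm]
    · simp [Finsupp.single_eq_of_ne hj]
  simp only [h]
  rw [Finset.prod_mul_distrib]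
  simp

theorem natCast_prod_factorial_ne_zero [CharZero K] (α : Fin n →₀ ℕ) :
    ((∏ i, (α i)! : ℕ) : K) ≠ 0 :=
  Nat.cast_ne_zero.2 (Finset.prod_ne_zero_iff.2 fun _ _ => Nat.factorial_ne_zero _)

/-- Taylor's formula for an algebra homomorphism that commutes with the partial derivatives. It is used
for the identity, and for the expansion of `f(v + w)` in powers of `w`. -/
theorem prod_factorial_mul_coeff
    (T : MvPolynomial (Fin n) K →ₐ[K] MvPolynomial (Fin n) A)
    (hT : ∀ i f, pderiv i (T f) = T (pderiv i f)) (α : Fin n →₀ ℕ) (f : MvPolynomial (Fin n) K) :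
    ((∏ i, (α i)! : ℕ) : A) * coeff α (T f) = coeff 0 (T (partialDeriv K α f)) := by
  induction hd : α.degree generalizing α f with
  | zero =>
    obtain rfl : α = 0 := (Finsupp.degree_eq_zero_iff α).1 hd
    simp [partialDeriv_zero]
  | succ d ih =>
    obtain ⟨i, hi⟩ := Finsupp.ne_iff.1 (show α ≠ 0 by rintro rfl; simp at hd)
    have : Finsupp.single i 1 ≤ α := by
      simpa [Finsupp.single_le_iff, Nat.one_le_iff_ne_zero] using hi
    obtain ⟨β, rfl⟩ := exists_add_of_le this
    rw [add_comm, partialDeriv_add_single, ← ih β _ (by simp at hd; omega), ← hT, coeff_pderiv,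
      prod_factorial_add_single]
    push_cast
    ring

variable (A) in
/-- The apolarity pairing of `F ∈ K[z]` with polynomials over a `K`-algebra `A`, as an `A`-linear
functional: it sends the monomial of exponent `α` to `α! F_α`. -/
noncomputable def apolarPairing (F : MvPolynomial (Fin n) K) : MvPolynomial (Fin n) A →ₗ[A] A :=
  (basisMonomials (Fin n) A).constr A fun α =>
    algebraMap K A ((∏ i, (α i)! : ℕ) * coeff α F)

theorem apolarPairing_monomial (F : MvPolynomial (Fin n) K) (α : Fin n →₀ ℕ) (a : A) :
    apolarPairing A F (monomial α a) = a * algebraMap K A ((∏ i, (α i)! : ℕ) * coeff α F) := by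
  rw [show monomial α a = a • basisMonomials (Fin n) A α by simp [smul_monomial], map_smul,
    apolarPairing, Module.Basis.constr_basis, smul_eq_mul]

theorem apolarPairing_apply (F : MvPolynomial (Fin n) K) (g : MvPolynomial (Fin n) A) :
    apolarPairing A F g =
      ∑ α ∈ g.support, coeff α g * algebraMap K A ((∏ i, (α i)! : ℕ) * coeff α F) := by
  conv_lhs => rw [g.as_sum]
  rw [map_sum]
  exact Finset.sum_congr rfl fun α _ => apolarPairing_monomial F α _

theorem apolarPairing_add (F G : MvPolynomial (Fin n) K) :
    apolarPairing A (F + G) = apolarPairing A F + apolarPairing A G := by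
  refine (basisMonomials (Fin n) A).ext fun α => ?_
  simp [apolarPairing_monomial, mul_add]

theorem monomial_apolarPairing (α : Fin n →₀ ℕ) (c : K) (g : MvPolynomial (Fin n) A) :
    apolarPairing A (monomial α c) g =
      algebraMap K A c * (((∏ i, (α i)! : ℕ) : A) * coeff α g) := by
  classical
  rw [apolarPairing_apply, Finset.sum_eq_single α]
  · simp
    ring
  · intro β _ hβ
    simp [coeff_monomial, hβ.symm]
  · intro h
    simp [notMem_support_iff.1 h]

theorem toDiffOp_monomial (α : Fin n →₀ ℕ) (c : K) :
    toDiffOp K n (monomial α c) = c • partialDeriv K α := by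
  rw [show monomial α c = c • basisMonomials (Fin n) K α by simp [smul_monomial], map_smul,
    toDiffOp, Module.Basis.constr_basis]

theorem toDiffOp_monomial_mul (β : Fin n →₀ ℕ) (f : MvPolynomial (Fin n) K) :
    toDiffOp K n (monomial β 1 * f) = partialDeriv K β * toDiffOp K n f := by
  induction f using MvPolynomial.induction_on' with
  | monomial α c => simp [monomial_mul, toDiffOp_monomial, partialDeriv_add]
  | add p q hp hq => simp only [mul_add, map_add, hp, hq]

theorem constantCoeff_partialDeriv (α : Fin n →₀ ℕ) (F : MvPolynomial (Fin n) K) :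
    constantCoeff (partialDeriv K α F) = (∏ i, (α i)! : ℕ) * coeff α F :=
  (prod_factorial_mul_coeff (AlgHom.id K _) (fun _ _ => rfl) α F).symm

theorem constantCoeff_toDiffOp (f F : MvPolynomial (Fin n) K) :
    constantCoeff (toDiffOp K n f F) = apolarPairing K F f := by
  induction f using MvPolynomial.induction_on' with
  | monomial α c =>
    simp [toDiffOp_monomial, apolarPairing_monomial, constantCoeff_partialDeriv]
  | add p q hp hq => simp only [map_add, LinearMap.add_apply, hp, hq]

/-- As `M` is an ideal, `f(∂) F = 0` for all `f ∈ M` as soon as all these polynomials have constant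
coefficient zero. -/
theorem mem_inverseSystem_iff [CharZero K] {M : Ideal (MvPolynomial (Fin n) K)}
    {F : MvPolynomial (Fin n) K} :
    F ∈ inverseSystem M ↔ ∀ f ∈ M, apolarPairing K F f = 0 := by
  refine ⟨fun h f hf => ?_, fun h f hf => ?_⟩
  · rw [← constantCoeff_toDiffOp, h f hf, map_zero]
  · ext β
    have h1 := h _ (M.mul_mem_left (monomial β 1) hf)
    rw [← constantCoeff_toDiffOp, toDiffOp_monomial_mul, Module.End.mul_apply,
      constantCoeff_partialDeriv] at h1
    exact (mul_eq_zero.1 h1).resolve_left (natCast_prod_factorial_ne_zero β)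

/-- A functional that vanishes on a power of the ideal of the variables is pairing with a polynomial,
of which division by `α!` gives the coefficients. The first conjunct computes the pairing over `A`, the
second over `K`. -/
theorem exists_apolarPairing_eq [CharZero K] {N : ℕ} (l : MvPolynomial (Fin n) K →ₗ[K] K)
    (hl : ∀ f ∈ idealOfVars (Fin n) K ^ N, l f = 0) :
    ∃ F : MvPolynomial (Fin n) K,
      (∀ α, apolarPairing A F (monomial α 1) = algebraMap K A (l (monomial α 1))) ∧
        apolarPairing K F = l := by
  classical
  have hfin := Finsupp.finite_of_degree_le (σ := Fin n) N
  let F : MvPolynomial (Fin n) K :=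
    ∑ α ∈ hfin.toFinset, monomial α (((∏ i, (α i)! : ℕ) : K)⁻¹ * l (monomial α 1))
  have hF : ∀ α, (∏ i, (α i)! : ℕ) * coeff α F = l (monomial α 1) := by
    intro α
    simp only [F, coeff_sum, coeff_monomial, Finset.sum_ite_eq']
    split_ifs with h
    · rw [mul_inv_cancel_left₀ (natCast_prod_factorial_ne_zero α)]
    · have hα : N < α.degree := by simpa using h
      rw [mul_zero, hl _ ((monomial_mem_pow_idealOfVars_iff N α one_ne_zero).2 hα.le)]
  refine ⟨F, fun α => by rw [apolarPairing_monomial, hF, one_mul], ?_⟩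
  refine (basisMonomials (Fin n) K).ext fun α => ?_
  rw [coe_basisMonomials, apolarPairing_monomial, hF, one_mul]
  rfl

/-- Membership in the sum of the extensions of `J ⊆ A` and `M ⊆ K[w]` to `A[w]` is detected by the
inverse system of `M`. -/
theorem mem_map_sup_map_iff [CharZero K] {N : ℕ} {M : Ideal (MvPolynomial (Fin n) K)}
    (hM : idealOfVars (Fin n) K ^ N ≤ M) (J : Ideal A) (g : MvPolynomial (Fin n) A) :
    g ∈ Ideal.map (C : A →+* MvPolynomial (Fin n) A) J ⊔
        Ideal.map (map (algebraMap K A) : MvPolynomial (Fin n) K →+* MvPolynomial (Fin n) A) M ↔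
      ∀ F ∈ inverseSystem M, apolarPairing A F g ∈ J := by
  classical
  constructor
  · intro hg F hF
    rw [mem_inverseSystem_iff] at hF
    obtain ⟨g₁, h₁, g₂, h₂, rfl⟩ := Submodule.mem_sup.1 hg
    rw [map_add]
    refine J.add_mem ?_ ?_
    · rw [apolarPairing_apply]
      exact J.sum_mem fun α _ => J.mul_mem_right _ (mem_map_C_iff.1 h₁ α)
    · convert J.zero_mem
      have key : ∀ m ∈ M, apolarPairing A F (map (algebraMap K A) m) = 0 := by
        intro m hm
        have : ∀ m, apolarPairing A F (map (algebraMap K A) m) =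
            algebraMap K A (apolarPairing K F m) := by
          intro m
          induction m using MvPolynomial.induction_on' with
          | monomial α c => simp [apolarPairing_monomial]
          | add p q hp hq => simp only [map_add, hp, hq]
        rw [this, hF m hm, map_zero]
      clear hg
      -- Multiplying by `k` makes the vanishing stable under the ideal operations.
      suffices ∀ k : MvPolynomial (Fin n) A, apolarPairing A F (k * g₂) = 0 by
        simpa using this 1
      induction h₂ using Submodule.span_induction with
      | mem x hx =>
        obtain ⟨m, hm, rfl⟩ := hx
        intro k
        induction k using MvPolynomial.induction_on' with
        | monomial α a =>
          have := key _ (M.mul_mem_left (monomial α 1) hm)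
          rw [map_mul, map_monomial, map_one] at this
          rw [show monomial α a = a • monomial α (1 : A) by simp [smul_monomial], smul_mul_assoc,
            map_smul]
          exact (congrArg (a • ·) this).trans (smul_zero a)
        | add p q hp hq => rw [add_mul, map_add, hp, hq, add_zero]
      | zero => simp
      | add x y _ _ hx hy => intro k; rw [mul_add, map_add, hx, hy, add_zero]
      | smul a x _ hx => intro k; rw [smul_eq_mul, ← mul_assoc]; exact hx _
  · intro h
    -- `e i` lifts the basis vector `b i` of `K[w]/M`, and `F i` represents the `i`-th coordinate.
    let b := Module.Basis.ofVectorSpace K (MvPolynomial (Fin n) K ⧸ M)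
    let mk : MvPolynomial (Fin n) K →ₐ[K] MvPolynomial (Fin n) K ⧸ M := Ideal.Quotient.mkₐ K M
    choose e he using fun i => Ideal.Quotient.mkₐ_surjective K M (b i)
    have hl : ∀ i, ∀ f ∈ M, (b.coord i ∘ₗ mk.toLinearMap) f = 0 := fun i f hf => by
      have : mk f = 0 := Ideal.Quotient.eq_zero_iff_mem.2 hf
      simp [this]
    choose F hF hFl using fun i => exists_apolarPairing_eq (A := A)
      (b.coord i ∘ₗ mk.toLinearMap) fun f hf => hl i f (hM hf)
    have hFM : ∀ i, F i ∈ inverseSystem M := fun i =>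
      mem_inverseSystem_iff.2 fun f hf => by rw [hFl]; exact hl i f hf
    -- The basis may be infinite, but only the coordinates in `S` occur in `g`.
    let S := g.support.biUnion fun α => (b.repr (mk (monomial α 1))).support
    have hmon : ∀ α ∈ g.support,
        monomial α 1 - ∑ i ∈ S, C (b.repr (mk (monomial α 1)) i) * e i ∈ M := by
      intro α hα
      rw [← Ideal.Quotient.eq_zero_iff_mem]
      change mk _ = 0
      rw [map_sub, sub_eq_zero, map_sum]
      conv_lhs => rw [← b.linearCombination_repr (mk (monomial α 1)), Finsupp.linearCombination_apply,
        Finsupp.sum_of_support_subset _ (s := S)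
          (Finset.subset_biUnion_of_mem (fun α => (b.repr (mk (monomial α 1))).support) hα)
          _ (by simp)]
      refine Finset.sum_congr rfl fun i _ => ?_
      rw [← smul_eq_C_mul, map_smul]
      exact congrArg _ (he i).symm
    have hg : g = (∑ i ∈ S, C (apolarPairing A (F i) g) * map (algebraMap K A) (e i)) +
        ∑ α ∈ g.support, C (coeff α g) * map (algebraMap K A)
          (monomial α 1 - ∑ i ∈ S, C (b.repr (mk (monomial α 1)) i) * e i) := by
      have h1 : ∀ i, apolarPairing A (F i) g =
          ∑ α ∈ g.support, coeff α g * algebraMap K A (b.repr (mk (monomial α 1)) i) := by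
        intro i
        rw [apolarPairing_apply]
        refine Finset.sum_congr rfl fun α _ => ?_
        have := hF i α
        rw [apolarPairing_monomial, one_mul] at this
        rw [this]
        rfl
      simp only [h1, map_sub, map_sum, map_mul, map_C, mul_sub, Finset.sum_sub_distrib,
        Finset.mul_sum, Finset.sum_mul, map_monomial, map_one, C_mul_monomial, mul_one,
        support_sum_monomial_coeff]
      rw [Finset.sum_comm]
      simp [mul_assoc]
    rw [hg]
    refine add_mem (sum_mem fun i _ => ?_) (sum_mem fun α hα => ?_)
    · exact Ideal.mul_mem_right _ _ (Ideal.mem_sup_left (Ideal.mem_map_of_mem _ (h _ (hFM i))))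
    · exact Ideal.mul_mem_left _ _ (Ideal.mem_sup_right (Ideal.mem_map_of_mem _ (hmon α hα)))

end Pairing

/-! ### Taylor expansion and the join -/

variable (K n) in
/-- The Taylor expansion `f ↦ f(v + w)`, as a polynomial in `w` with coefficients in `K[v]`. -/
noncomputable def taylorExpansion :
    MvPolynomial (Fin n) K →ₐ[K] MvPolynomial (Fin n) (MvPolynomial (Fin n) K) :=
  aeval fun i => C (X i) + X i

theorem pderiv_taylorExpansion (i : Fin n) (f : MvPolynomial (Fin n) K) :
    pderiv i (taylorExpansion K n f) = taylorExpansion K n (pderiv i f) := by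
  classical
  induction f using MvPolynomial.induction_on with
  | C a => simp [taylorExpansion, IsScalarTower.algebraMap_apply K (MvPolynomial (Fin n) K)
      (MvPolynomial (Fin n) (MvPolynomial (Fin n) K)), algebraMap_eq]
  | add p q hp hq => simp only [map_add, hp, hq]
  | mul_X p j hp =>
    rw [map_mul, pderiv_mul, pderiv_mul, map_add, map_mul, map_mul, hp]
    congr 2
    simp [taylorExpansion, pderiv_X, Pi.single_apply, apply_ite]

theorem coeff_zero_taylorExpansion (f : MvPolynomial (Fin n) K) :
    coeff 0 (taylorExpansion K n f) = f := by
  have : ((aeval (R := MvPolynomial (Fin n) K) fun _ : Fin n =>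
      (0 : MvPolynomial (Fin n) K)).restrictScalars K).comp (taylorExpansion K n) =
        AlgHom.id K _ := by
    ext i
    simp [taylorExpansion]
  have := congr($this f)
  simpa [constantCoeff_eq] using this

/-- Applying `F(∂)` to `f` is pairing `F` with the Taylor expansion of `f`. -/
theorem toDiffOp_eq_apolarPairing (F f : MvPolynomial (Fin n) K) :
    toDiffOp K n F f = apolarPairing _ F (taylorExpansion K n f) := by
  induction F using MvPolynomial.induction_on' with
  | monomial α c =>
    rw [toDiffOp_monomial, monomial_apolarPairing,
      prod_factorial_mul_coeff _ pderiv_taylorExpansion, coeff_zero_taylorExpansion,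
      LinearMap.smul_apply, Algebra.smul_def]
  | add p q hp hq => simp only [map_add, LinearMap.add_apply, apolarPairing_add, hp, hq]

/-- Elimination of the variables `x`, `v`, `w` along `x = v + w`: membership in the join is read off the
Taylor expansion. -/
theorem mem_idealJoin_iff {J L : Ideal (MvPolynomial (Fin n) K)} {f : MvPolynomial (Fin n) K} :
    f ∈ idealJoin J L ↔ taylorExpansion K n f ∈
      Ideal.map (C : _ →+* MvPolynomial (Fin n) (MvPolynomial (Fin n) K)) J ⊔
        Ideal.map (map (algebraMap K (MvPolynomial (Fin n) K)) :
          MvPolynomial (Fin n) K →+* MvPolynomial (Fin n) (MvPolynomial (Fin n) K)) L := by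
  set I := Ideal.map (C : _ →+* MvPolynomial (Fin n) (MvPolynomial (Fin n) K)) J ⊔
        Ideal.map (map (algebraMap K (MvPolynomial (Fin n) K)) :
          MvPolynomial (Fin n) K →+* MvPolynomial (Fin n) (MvPolynomial (Fin n) K)) L with hI
  rw [idealJoin, Ideal.mem_comap]
  set I' := Ideal.map (rename (fun i => Sum.inr (Sum.inl i)) : MvPolynomial (Fin n) K →ₐ[K]
        MvPolynomial (Fin n ⊕ Fin n ⊕ Fin n) K) J ⊔
      Ideal.map (rename (fun i => Sum.inr (Sum.inr i)) : MvPolynomial (Fin n) K →ₐ[K]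
        MvPolynomial (Fin n ⊕ Fin n ⊕ Fin n) K) L ⊔
      Ideal.span (Set.range fun i : Fin n =>
        (X (Sum.inl i) - X (Sum.inr (Sum.inl i)) - X (Sum.inr (Sum.inr i)) :
          MvPolynomial (Fin n ⊕ Fin n ⊕ Fin n) K)) with hI'
  constructor
  · intro h
    let θ : MvPolynomial (Fin n ⊕ Fin n ⊕ Fin n) K →ₐ[K]
        MvPolynomial (Fin n) (MvPolynomial (Fin n) K) :=
      aeval (Sum.elim (fun i => C (X i) + X i) (Sum.elim (fun i => C (X i)) X))
    have hx : ∀ f, θ (rename Sum.inl f) = taylorExpansion K n f := fun f => by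
      simp only [θ, aeval_rename, taylorExpansion]; rfl
    have hv : ∀ f, θ (rename (fun i => Sum.inr (Sum.inl i)) f) = C f := fun f => by
      have : θ.comp (rename (fun i => Sum.inr (Sum.inl i))) =
          IsScalarTower.toAlgHom K (MvPolynomial (Fin n) K) _ := by
        ext i; simp [θ, algebraMap_eq]
      exact congr($this f)
    have hw : ∀ f, θ (rename (fun i => Sum.inr (Sum.inr i)) f) =
        map (algebraMap K (MvPolynomial (Fin n) K)) f := fun f => by
      have : θ.comp (rename (fun i => Sum.inr (Sum.inr i))) =
          mapAlgHom (Algebra.ofId K (MvPolynomial (Fin n) K)) := by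
        ext i; simp [θ]
      exact congr($this f)
    have hle : I' ≤ Ideal.comap θ I := by
      rw [hI', sup_le_iff, sup_le_iff, Ideal.map_le_iff_le_comap, Ideal.map_le_iff_le_comap,
        Ideal.span_le]
      refine ⟨⟨fun g hg => ?_, fun g hg => ?_⟩, ?_⟩
      · rw [Ideal.mem_comap, Ideal.mem_comap, hv]
        exact Ideal.mem_sup_left (Ideal.mem_map_of_mem _ hg)
      · rw [Ideal.mem_comap, Ideal.mem_comap, hw]
        exact Ideal.mem_sup_right (Ideal.mem_map_of_mem _ hg)
      · rintro _ ⟨i, rfl⟩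
        simp [θ]
    rw [← hx]
    exact hle h
  · intro h
    let σ : MvPolynomial (Fin n) (MvPolynomial (Fin n) K) →+*
        MvPolynomial (Fin n ⊕ Fin n ⊕ Fin n) K :=
      eval₂Hom (rename (fun i => Sum.inr (Sum.inl i)) : MvPolynomial (Fin n) K →ₐ[K]
        MvPolynomial (Fin n ⊕ Fin n ⊕ Fin n) K).toRingHom fun i => X (Sum.inr (Sum.inr i))
    have hle : I ≤ Ideal.comap σ I' := by
      rw [hI, sup_le_iff, Ideal.map_le_iff_le_comap, Ideal.map_le_iff_le_comap]
      refine ⟨fun g hg => ?_, fun g hg => ?_⟩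
      · have : σ (C g) = rename (fun i => Sum.inr (Sum.inl i)) g := by simp [σ]
        rw [Ideal.mem_comap, Ideal.mem_comap, this]
        exact Ideal.mem_sup_left (Ideal.mem_sup_left (Ideal.mem_map_of_mem _ hg))
      · have : σ.comp (map (algebraMap K (MvPolynomial (Fin n) K))) =
            (rename (fun i => Sum.inr (Sum.inr i)) : MvPolynomial (Fin n) K →ₐ[K]
              MvPolynomial (Fin n ⊕ Fin n ⊕ Fin n) K).toRingHom := by
          ext <;> simp [σ, algebraMap_eq]
        have : σ (map (algebraMap K (MvPolynomial (Fin n) K)) g) =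
          rename (fun i => Sum.inr (Sum.inr i)) g := congr($this g)
        rw [Ideal.mem_comap, Ideal.mem_comap, this]
        exact Ideal.mem_sup_left (Ideal.mem_sup_right (Ideal.mem_map_of_mem _ hg))
    -- Modulo `xᵢ - vᵢ - wᵢ`, the polynomials `f(x)` and `f(v + w)` agree.
    have hmod : (Ideal.Quotient.mk I').comp (rename Sum.inl : MvPolynomial (Fin n) K →ₐ[K]
        MvPolynomial (Fin n ⊕ Fin n ⊕ Fin n) K).toRingHom =
        (Ideal.Quotient.mk I').comp (σ.comp (taylorExpansion K n).toRingHom) := by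
      apply MvPolynomial.ringHom_ext
      · intro a
        simp [σ, taylorExpansion, IsScalarTower.algebraMap_apply K (MvPolynomial (Fin n) K)
          (MvPolynomial (Fin n) (MvPolynomial (Fin n) K)), algebraMap_eq]
      · intro i
        have : (X (Sum.inl i) - X (Sum.inr (Sum.inl i)) - X (Sum.inr (Sum.inr i)) :
          MvPolynomial (Fin n ⊕ Fin n ⊕ Fin n) K) ∈ I' :=
          Ideal.mem_sup_right (Ideal.subset_span ⟨i, rfl⟩)
        rw [sub_sub, ← Ideal.Quotient.eq] at this
        simpa [σ, taylorExpansion] using this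
    have := congr($hmod f)
    rw [← Ideal.Quotient.eq_zero_iff_mem]
    refine Eq.trans this ?_
    exact Ideal.Quotient.eq_zero_iff_mem.2 (hle h)

/-- Only a power of the ideal of the variables inside `M` is needed, so that `M = R` is allowed. -/
theorem mem_idealJoin_iff_associatedDiffOps [CharZero K] {N : ℕ}
    {J M : Ideal (MvPolynomial (Fin n) K)} (hM : idealOfVars (Fin n) K ^ N ≤ M)
    {f : MvPolynomial (Fin n) K} :
    f ∈ idealJoin J M ↔ ∀ A ∈ associatedDiffOps M, A f ∈ J := by
  rw [mem_idealJoin_iff, mem_map_sup_map_iff hM]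
  simp [associatedDiffOps, toDiffOp_eq_apolarPairing]

theorem mem_inverseSystem_pow_idealOfVars [CharZero K] {r : ℕ} {F : MvPolynomial (Fin n) K} :
    F ∈ inverseSystem (idealOfVars (Fin n) K ^ r) ↔ ∀ α ∈ F.support, α.degree < r := by
  rw [mem_inverseSystem_iff]
  constructor
  · intro h α hα
    by_contra! hr
    have := h _ ((monomial_mem_pow_idealOfVars_iff r α one_ne_zero).2 hr)
    rw [apolarPairing_monomial, one_mul] at this
    exact mem_support_iff.1 hα ((mul_eq_zero.1 this).resolve_left
      (natCast_prod_factorial_ne_zero α))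
  · intro h f hf
    rw [apolarPairing_apply]
    refine Finset.sum_eq_zero fun α hα => ?_
    have : α ∉ F.support := fun hF =>
      mem_support_iff.1 hα ((mem_pow_idealOfVars_iff' r f).1 hf α (h α hF))
    simp [notMem_support_iff.1 this]

theorem idealJoin_pow_idealOfVars [CharZero K] (J : Ideal (MvPolynomial (Fin n) K)) (r : ℕ) :
    idealJoin J (idealOfVars (Fin n) K ^ r) = differentialPower J r := by
  ext f
  rw [mem_idealJoin_iff_associatedDiffOps le_rfl, mem_differentialPower]
  constructor
  · intro h α hα
    refine h _ ⟨monomial α 1, mem_inverseSystem_pow_idealOfVars.2 fun β hβ => ?_, ?_⟩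
    · rwa [Finset.mem_singleton.1 (support_monomial_subset hβ)]
    · rw [toDiffOp_monomial, one_smul]
  · rintro h _ ⟨F, hF, rfl⟩
    rw [F.as_sum, map_sum, LinearMap.sum_apply]
    refine J.sum_mem fun α hα => ?_
    rw [toDiffOp_monomial, LinearMap.smul_apply, Algebra.smul_def]
    exact J.mul_mem_left _ (h α (mem_inverseSystem_pow_idealOfVars.1 hF α hα))

end ApolarityAndJoin

theorem theorem7p1 (K : Type*) [Field K] [CharZero K] (n : ℕ)
    (J : Ideal (MvPolynomial (Fin n) K)) :
    (∀ M : Ideal (MvPolynomial (Fin n) K),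
      M.IsPrimary → M.radical = MvPolynomial.idealOfVars (Fin n) K →
        (idealJoin J M : Set (MvPolynomial (Fin n) K)) =
          {f | ∀ A ∈ associatedDiffOps M, A f ∈ J}) ∧
    (J.IsRadical → ∀ r : ℕ,
      symbolicPower J r = idealJoin J (MvPolynomial.idealOfVars (Fin n) K ^ r) ∧
      (idealJoin J (MvPolynomial.idealOfVars (Fin n) K ^ r) : Set (MvPolynomial (Fin n) K)) =
        {f | ∀ α : Fin n →₀ ℕ, α.degree < r → partialDeriv K α f ∈ J}) := by
  refine ⟨fun M _ hM => ?_, fun hJ r => ?_⟩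
  · obtain ⟨N, hN⟩ := M.exists_radical_pow_le_of_fg (IsNoetherian.noetherian _)
    rw [hM] at hN
    exact Set.ext fun f => mem_idealJoin_iff_associatedDiffOps hN
  · rw [idealJoin_pow_idealOfVars]
    exact ⟨symbolicPower_eq_differentialPower hJ r, rfl⟩
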